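/- Let $F(z,w,w')$ be a polynomial in $w,w'$ with coefficients in $\mathbb{C}(z)$ that is irreducible in $\mathbb{C}(z)[w,w']$. Suppose that the differential equation $F(z,w,w')=0$ has a rational general solution, that is, there is a rational function $r(z,\lambda)\in\mathbb{C}(z,\lambda)$ which really depends on the arbitrary constant $\lambda$ (i.e. $r\notin\mathbb{C}(z)$) and satisfies $F\bigl(z,r,\tfrac{\partial r}{\partial z}\bigr)=0$ identically in $\mathbb{C}(z,\lambda)$. Then for all but finitely many $z_0\in\mathbb{C}$ the polynomial $F(z_0,x,y)\in\mathbb{C}[x,y]$ is irreducible and the plane curve $F(z_0,x,y)=0$ has genus zero, where the genus of an irreducible plane curve $f(x,y)=0$ over $\mathbb{C}$ is the dimension over $\mathbb{C}$ of the space of everywhere regular differentials of its function field $\operatorname{Frac}(\mathbb{C}[x,y]/(f))$. -/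

import Mathlib

open scoped KaehlerDifferential

noncomputable section

/-- The derivative `d/dz` of a rational function `f = p / q` in `z`, by the quotient rule applied
to the reduced fraction. -/
def ratDeriv (f : RatFunc ℂ) : RatFunc ℂ :=
  (algebraMap (Polynomial ℂ) (RatFunc ℂ))
      (Polynomial.derivative f.num * f.denom - f.num * Polynomial.derivative f.denom) /
    (algebraMap (Polynomial ℂ) (RatFunc ℂ)) (f.denom ^ 2)

/-- The derivative `∂/∂z` of a polynomial in `lam` with coefficients in `ℂ(z)`:
every coefficient is differentiated. -/
def polyPartialZ (p : Polynomial (RatFunc ℂ)) : Polynomial (RatFunc ℂ) :=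
  p.sum fun n a => Polynomial.monomial n (ratDeriv a)

/-- The field `ℂ(z, lam)`, written as `ℂ(z)(lam)`: the inner variable is `z`, the outer one is the
arbitrary constant `lam`. -/
abbrev RatFuncZLam : Type := RatFunc (RatFunc ℂ)

/-- The partial derivative `∂r/∂z` of a rational function `r` in `z` and `lam`, by the quotient
rule applied to the reduced fraction. -/
def partialZ (r : RatFuncZLam) : RatFuncZLam :=
  (algebraMap (Polynomial (RatFunc ℂ)) RatFuncZLam)
      (polyPartialZ r.num * r.denom - r.num * polyPartialZ r.denom) /
    (algebraMap (Polynomial (RatFunc ℂ)) RatFuncZLam) (r.denom ^ 2)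

/-- `F` is a polynomial in `w` (variable `0`) and `w'` (variable `1`) over `ℂ(z)`.
A rational function `r` in `z` and `lam` is a rational general solution of `F(z, w, w') = 0` if
`F(z, r, ∂r/∂z) = 0` identically in `z` and `lam`, and `r` really contains the arbitrary constant
`lam`, that is, `r` is not a function of `z` alone. -/
structure IsRationalGeneralSolution (F : MvPolynomial (Fin 2) (RatFunc ℂ)) (r : RatFuncZLam) :
    Prop where
  solves : MvPolynomial.aeval ![r, partialZ r] F = 0
  depends_on_constant : r ∉ Set.range (algebraMap (RatFunc ℂ) RatFuncZLam)

/-- The polynomial `F(z₀, x, y)` in `x` (variable `0`) and `y` (variable `1`): every coefficient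
of `F` is evaluated at `z₀`. (This is meaningful unless `z₀` is one of the finitely many poles of
the coefficients.) -/
def specializeAt (F : MvPolynomial (Fin 2) (RatFunc ℂ)) (z₀ : ℂ) : MvPolynomial (Fin 2) ℂ :=
  ∑ m ∈ F.support, MvPolynomial.monomial m ((F.coeff m).eval (RingHom.id ℂ) z₀)

/-- For a function field `K` over `ℂ`: the differentials that are regular at every place, i.e.
that lie, for every valuation ring `O` of `K` over `ℂ`, in the `O`-module generated by
`{dt | t ∈ O}` (for a function field of one variable this is `O dt`, `t` a uniformizer). -/
def regularDifferentials (K : Type) [Field K] [Algebra ℂ K] : Submodule ℂ (Ω[K⁄ℂ]) where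
  carrier := {ω | ∀ O : ValuationSubring K, (∀ c : ℂ, algebraMap ℂ K c ∈ O) →
    ω ∈ Submodule.span O (KaehlerDifferential.D ℂ K '' (O : Set K))}
  zero_mem' := fun _ _ => Submodule.zero_mem _
  add_mem' := fun ha hb O hO => Submodule.add_mem _ (ha O hO) (hb O hO)
  smul_mem' := fun c ω hω O hO => by
    have h := Submodule.smul_mem _ (⟨algebraMap ℂ K c, hO c⟩ : O) (hω O hO)
    have e : (⟨algebraMap ℂ K c, hO c⟩ : O) • ω = c • ω := algebraMap_smul K c ω
    rwa [e] at h

/-- The genus of a function field `K` over `ℂ`: the dimension of its space of everywhere regular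
differentials (as a cardinal, so that no finiteness is presupposed). -/
def functionFieldGenus (K : Type) [Field K] [Algebra ℂ K] : Cardinal :=
  Module.rank ℂ (regularDifferentials K)

/-- The coordinate ring `ℂ[x, y] / (f)` of the affine plane curve `f = 0`. -/
abbrev CoordRing (f : MvPolynomial (Fin 2) ℂ) : Type :=
  MvPolynomial (Fin 2) ℂ ⧸ Ideal.span {f}

theorem isDomain_coordRing {f : MvPolynomial (Fin 2) ℂ} (hf : Irreducible f) :
    IsDomain (CoordRing f) :=
  (Ideal.Quotient.isDomain_iff_prime _).2 ((Ideal.span_singleton_prime hf.ne_zero).2 hf.prime)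

/-- The (geometric) genus of the irreducible plane curve `f = 0`: the genus of its function field,
the field of fractions of the coordinate ring. -/
def planeCurveGenus (f : MvPolynomial (Fin 2) ℂ) (hf : Irreducible f) : Cardinal :=
  haveI : IsDomain (CoordRing f) := isDomain_coordRing hf
  functionFieldGenus (FractionRing (CoordRing f))

end

open scoped KaehlerDifferential

noncomputable section

/-! A solution that depends on `λ` is a parametrization of the curve `F = 0` over `ℂ(z)`, and
specializing `z` should parametrize almost every curve `F(z₀, x, y) = 0` by rational functions of
`λ`. An ultraproduct replaces the count of exceptional `z₀`.

Since `r` is transcendental over `ℂ(z)`, the point `(r, ∂r/∂z)` is generic on `F = 0`: the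
polynomials vanishing there are the multiples of `F` (`ker_eq_span_of_transcendental`). This stays
true, and `F` stays irreducible, over every extension `k` of `ℂ(z)` in a common overfield over which
`λ` remains transcendental, by linear disjointness of `k` and `ℂ(z)(λ)` (`ker_aeval_eq_span_map`,
`irreducible_map_of_ker_aeval_eq_span`).

If infinitely many `z₀` were bad, some nonprincipal ultrafilter on `ℂ` would contain the bad set.
Evaluation embeds `ℂ(z)` in the ultrapower of `ℂ`, and `ℂ(z, λ)` in that of `ℂ(λ)`. Over the former,
`F` is the ultraproduct of the polynomials `F(z₀, x, y)`. Their degrees are bounded, so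
irreducibility descends to almost all of them (`Represents.eventually_irreducible`), and the generic
point yields nonconstant parametrizations by `ℂ(λ)`.

A parametrization embeds the function field in `ℂ(λ)`. In characteristic zero, differentials pull
back injectively, and regular ones stay regular; `ℂ(λ)` has no nonzero regular differential, so the
genus is zero (`planeCurveGenus_eq_zero_of_parametrization`). -/

/-! ### Generic points of irreducible plane curves. -/

theorem ringKrullDim_mvPolynomial_fin_two (k : Type*) [Field k] :
    ringKrullDim (MvPolynomial (Fin 2) k) = 2 := by
  rw [MvPolynomial.ringKrullDim_of_isNoetherianRing, ringKrullDim_eq_zero_of_field]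
  simp

/-- The plane has dimension two, so a prime strictly above `(F)` is maximal, and its residue field
is algebraic over `k`. A transcendental coordinate rules this out. -/
theorem ker_eq_span_of_transcendental {k L : Type*} [Field k] [Field L] [Algebra k L]
    {F : MvPolynomial (Fin 2) k} (hF : Irreducible F) (φ : MvPolynomial (Fin 2) k →ₐ[k] L)
    (hφ : φ F = 0) (i : Fin 2) (hx : Transcendental k (φ (MvPolynomial.X i))) :
    RingHom.ker φ = Ideal.span {F} := by
  have hle : Ideal.span {F} ≤ RingHom.ker φ := by
    rw [Ideal.span_singleton_le_iff_mem]; exact hφ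
  have hP : (RingHom.ker φ).IsPrime := RingHom.ker_isPrime φ
  have hS : (Ideal.span {F}).IsPrime := (Ideal.span_singleton_prime hF.ne_zero).2 hF.prime
  by_contra hne
  have hlt : Ideal.span {F} < RingHom.ker φ := lt_of_le_of_ne hle (Ne.symm hne)
  have hbot : (⊥ : Ideal (MvPolynomial (Fin 2) k)) < Ideal.span {F} := by
    rw [bot_lt_iff_ne_bot, Ne, Ideal.span_singleton_eq_bot]
    exact hF.ne_zero
  have hmax : (RingHom.ker φ).IsMaximal := by
    obtain ⟨M, hM, hPM⟩ := Ideal.exists_le_maximal _ hP.ne_top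
    rcases hPM.eq_or_lt with h | h
    · rwa [h]
    exfalso
    let s : LTSeries (PrimeSpectrum (MvPolynomial (Fin 2) k)) :=
      { length := 3
        toFun := ![⟨⊥, Ideal.isPrime_bot⟩, ⟨_, hS⟩, ⟨_, hP⟩, ⟨M, hM.isPrime⟩]
        step := by
          intro j
          fin_cases j
          · exact hbot
          · exact hlt
          · exact h }
    have h3 := Order.LTSeries.length_le_krullDim s
    change ((3 : ℕ) : WithBot ℕ∞) ≤ ringKrullDim _ at h3
    rw [ringKrullDim_mvPolynomial_fin_two] at h3
    have : (3 : ℕ) ≤ 2 := by exact_mod_cast h3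
    omega
  let _ := Ideal.Quotient.field (RingHom.ker φ)
  -- Zariski's lemma: a field finitely generated as a `k`-algebra is finite over `k`.
  have hfin : Module.Finite k (MvPolynomial (Fin 2) k ⧸ RingHom.ker φ) :=
    finite_of_finite_type_of_isJacobsonRing k _
  have hint : IsIntegral k (Ideal.Quotient.mkₐ k (RingHom.ker φ) (MvPolynomial.X i)) :=
    Algebra.IsIntegral.isIntegral _
  have := hint.map (Ideal.kerLiftAlg φ)
  exact hx (IsIntegral.isAlgebraic (by simpa using this))

/-! ### Pullback of differentials along field extensions. -/

/-- In the Jacobi–Zariski sequence the kernel is the image of `H¹` of the cotangent complex of `L`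
over `K`. This vanishes because `L` is formally smooth over the perfect field `K`. -/
theorem mapBaseChange_injective_of_perfectField (k K L : Type) [Field k] [Field K] [Field L]
    [PerfectField K] [Algebra k K] [Algebra k L] [Algebra K L] [IsScalarTower k K L]
    [Algebra.EssFiniteType k L] :
    Function.Injective (KaehlerDifferential.mapBaseChange k K L) := by
  have : Algebra.EssFiniteType K L := Algebra.EssFiniteType.of_comp k K L
  have : Algebra.FormallySmooth K L := Algebra.FormallySmooth.of_perfectField
  have h := Algebra.H1Cotangent.exact_δ_mapBaseChange k K L
  rw [injective_iff_map_eq_zero]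
  intro x hx
  obtain ⟨y, rfl⟩ := (h x).1 hx
  rw [Subsingleton.elim y 0, map_zero]

theorem map_kaehler_injective_of_perfectField (k K L : Type) [Field k] [Field K] [Field L]
    [PerfectField K] [Algebra k K] [Algebra k L] [Algebra K L] [IsScalarTower k K L]
    [Algebra.EssFiniteType k L] :
    Function.Injective (KaehlerDifferential.map k k K L) := by
  intro x y hxy
  have h := mapBaseChange_injective_of_perfectField k K L
    (a₁ := 1 ⊗ₜ[K] x) (a₂ := 1 ⊗ₜ[K] y) (by simpa using hxy)
  exact Module.FaithfullyFlat.tensorProduct_mk_injective (A := K) (B := L) _ h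

/-- A valuation ring of `L` restricts to one of `K`, so regular differentials pull back to regular
ones; the pullback is injective. The extension need not be finite. -/
theorem regularDifferentials_eq_bot_of_algHom {K L : Type} [Field K] [Field L] [Algebra ℂ K]
    [Algebra ℂ L] [Algebra.EssFiniteType ℂ L] (f : K →ₐ[ℂ] L) (hL : regularDifferentials L = ⊥) :
    regularDifferentials K = ⊥ := by
  let _ : Algebra K L := f.toRingHom.toAlgebra
  have : IsScalarTower ℂ K L := IsScalarTower.of_algebraMap_eq fun c => (f.commutes c).symm
  have : CharZero K := charZero_of_injective_algebraMap (algebraMap ℂ K).injective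
  rw [eq_bot_iff]
  intro ω hω
  have hreg : KaehlerDifferential.map ℂ ℂ K L ω ∈ regularDifferentials L := by
    intro O hO
    have h := hω (O.comap (algebraMap K L)) (fun c => by
      rw [ValuationSubring.mem_comap, ← IsScalarTower.algebraMap_apply]; exact hO c)
    clear hω
    induction h using Submodule.span_induction with
    | mem x hx =>
      obtain ⟨t, ht, rfl⟩ := hx
      rw [KaehlerDifferential.map_D]
      exact Submodule.subset_span ⟨_, ht, rfl⟩
    | zero => rw [map_zero]; exact Submodule.zero_mem _
    | add x y _ _ hx hy => rw [map_add]; exact Submodule.add_mem _ hx hy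
    | smul a x _ hx =>
      have e : KaehlerDifferential.map ℂ ℂ K L (a • x) =
          (⟨algebraMap K L a, a.2⟩ : O) • KaehlerDifferential.map ℂ ℂ K L x := by
        change KaehlerDifferential.map ℂ ℂ K L ((a : K) • x) =
          algebraMap K L a • KaehlerDifferential.map ℂ ℂ K L x
        rw [map_smul, algebraMap_smul]
      rw [e]
      exact Submodule.smul_mem _ _ hx
  rw [hL, Submodule.mem_bot] at hreg
  exact map_kaehler_injective_of_perfectField ℂ K L (by rw [hreg, map_zero])

/-! ### The projective line has no nonzero regular differentials. -/

open scoped nonZeroDivisors in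
instance essFiniteType_ratFunc (k : Type*) [Field k] : Algebra.EssFiniteType k (RatFunc k) :=
  have : Algebra.EssFiniteType (Polynomial k) (RatFunc k) :=
    Algebra.EssFiniteType.of_isLocalization _ (Polynomial k)⁰
  Algebra.EssFiniteType.comp k (Polynomial k) (RatFunc k)

open scoped nonZeroDivisors TensorProduct in
/-- The isomorphism `Ω[k(X)⁄k] ≃ k(X)` that sends `dX` to `1`. -/
def ratFuncKaehlerEquiv (k : Type*) [Field k] : Ω[RatFunc k⁄k] ≃ₗ[RatFunc k] RatFunc k :=
  have : Algebra.FormallyEtale (Polynomial k) (RatFunc k) :=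
    Algebra.FormallyEtale.of_isLocalization (Polynomial k)⁰
  (KaehlerDifferential.tensorKaehlerEquivOfFormallyEtale k (Polynomial k) (RatFunc k)).symm ≪≫ₗ
    TensorProduct.AlgebraTensorModule.congr (LinearEquiv.refl _ _)
      (KaehlerDifferential.polynomialEquiv k) ≪≫ₗ
    TensorProduct.AlgebraTensorModule.rid (Polynomial k) (RatFunc k) (RatFunc k)

theorem ratFuncKaehlerEquiv_D_algebraMap {k : Type*} [Field k] (p : Polynomial k) :
    ratFuncKaehlerEquiv k (KaehlerDifferential.D k (RatFunc k) (algebraMap _ _ p)) =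
      algebraMap _ _ (Polynomial.derivative p) := by
  have : Algebra.FormallyEtale (Polynomial k) (RatFunc k) :=
    Algebra.FormallyEtale.of_isLocalization (nonZeroDivisors (Polynomial k))
  simp only [ratFuncKaehlerEquiv, LinearEquiv.trans_apply]
  rw [KaehlerDifferential.tensorKaehlerEquivOfFormallyEtale_symm_D_algebraMap]
  simp [Algebra.smul_def]

theorem ratFuncKaehlerEquiv_D_div {k : Type*} [Field k] (p q : Polynomial k) (hq : q ≠ 0) :
    ratFuncKaehlerEquiv k (KaehlerDifferential.D k (RatFunc k)
      (algebraMap _ (RatFunc k) p / algebraMap _ (RatFunc k) q)) =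
      algebraMap _ (RatFunc k) (Polynomial.derivative p * q - p * Polynomial.derivative q) /
        algebraMap _ (RatFunc k) (q * q) := by
  have hq' : algebraMap (Polynomial k) (RatFunc k) q ≠ 0 := by
    rwa [Ne, FaithfulSMul.algebraMap_eq_zero_iff]
  set f := algebraMap _ (RatFunc k) p / algebraMap _ (RatFunc k) q with hf
  have h : f * algebraMap _ (RatFunc k) q = algebraMap _ (RatFunc k) p := by
    rw [hf, div_mul_cancel₀ _ hq']
  have h2 := congrArg (fun g => ratFuncKaehlerEquiv k (KaehlerDifferential.D k (RatFunc k) g)) h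
  simp only [Derivation.leibniz, map_add, map_smul, smul_eq_mul,
    ratFuncKaehlerEquiv_D_algebraMap] at h2
  simp only [map_sub, map_mul]
  rw [eq_div_iff (mul_ne_zero hq' hq'), ← h2, ← h]
  ring

/-- The rational functions over `k` that are regular at `a`. -/
def ratFuncRegularAt {k : Type*} [Field k] (a : k) : ValuationSubring (RatFunc k) where
  carrier := {f | ∃ p q : Polynomial k, q.eval a ≠ 0 ∧
    f = algebraMap _ (RatFunc k) p / algebraMap _ (RatFunc k) q}
  mul_mem' := by
    rintro _ _ ⟨p, q, hq, rfl⟩ ⟨p', q', hq', rfl⟩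
    exact ⟨p * p', q * q', by simp [hq, hq'], by simp [div_mul_div_comm]⟩
  one_mem' := ⟨1, 1, by simp, by simp⟩
  zero_mem' := ⟨0, 1, by simp, by simp⟩
  add_mem' := by
    rintro _ _ ⟨p, q, hq, rfl⟩ ⟨p', q', hq', rfl⟩
    have h : ∀ q : Polynomial k, q.eval a ≠ 0 → algebraMap _ (RatFunc k) q ≠ 0 := by
      rintro q hq h
      rw [FaithfulSMul.algebraMap_eq_zero_iff] at h
      simp [h] at hq
    exact ⟨p * q' + q * p', q * q', by simp [hq, hq'], by
      simp [div_add_div _ _ (h q hq) (h q' hq')]⟩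
  neg_mem' := by
    rintro _ ⟨p, q, hq, rfl⟩
    exact ⟨-p, q, hq, by simp [neg_div]⟩
  mem_or_inv_mem' f := by
    by_cases h : f.denom.eval a = 0
    · right
      refine ⟨f.denom, f.num, fun h' => ?_, ?_⟩
      -- By Bézout, the coprime numerator and denominator have no common root.
      · obtain ⟨u, v, huv⟩ := RatFunc.isCoprime_num_denom f
        have := congrArg (Polynomial.eval a) huv
        simp [h, h'] at this
      · rw [← inv_div, RatFunc.num_div_denom]
    · exact Or.inl ⟨_, _, h, (RatFunc.num_div_denom f).symm⟩

theorem mem_ratFuncRegularAt {k : Type*} [Field k] {a : k} {f : RatFunc k} :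
    f ∈ ratFuncRegularAt a ↔ ∃ p q : Polynomial k, q.eval a ≠ 0 ∧
      f = algebraMap _ (RatFunc k) p / algebraMap _ (RatFunc k) q := Iff.rfl

theorem denom_eval_ne_zero_of_mem_ratFuncRegularAt {k : Type*} [Field k] {a : k} {f : RatFunc k}
    (hf : f ∈ ratFuncRegularAt a) : f.denom.eval a ≠ 0 := by
  obtain ⟨p, q, hq, rfl⟩ := mem_ratFuncRegularAt.1 hf
  intro h
  exact hq (Polynomial.eval_eq_zero_of_dvd_of_eval_eq_zero (RatFunc.denom_div_dvd p q) h)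

/-- The rational functions over `k` that are regular at infinity. -/
def ratFuncRegularAtInfty (k : Type*) [Field k] : ValuationSubring (RatFunc k) where
  carrier := {f | ∃ p q : Polynomial k, q ≠ 0 ∧ p.degree ≤ q.degree ∧
    f = algebraMap _ (RatFunc k) p / algebraMap _ (RatFunc k) q}
  mul_mem' := by
    rintro _ _ ⟨p, q, hq, hd, rfl⟩ ⟨p', q', hq', hd', rfl⟩
    refine ⟨p * p', q * q', mul_ne_zero hq hq', ?_, by simp [div_mul_div_comm]⟩
    rw [Polynomial.degree_mul, Polynomial.degree_mul]
    exact add_le_add hd hd'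
  one_mem' := ⟨1, 1, by simp, le_rfl, by simp⟩
  zero_mem' := ⟨0, 1, by simp, by simp, by simp⟩
  add_mem' := by
    rintro _ _ ⟨p, q, hq, hd, rfl⟩ ⟨p', q', hq', hd', rfl⟩
    refine ⟨p * q' + q * p', q * q', mul_ne_zero hq hq', ?_, ?_⟩
    · refine (Polynomial.degree_add_le _ _).trans (max_le ?_ ?_) <;>
        rw [Polynomial.degree_mul, Polynomial.degree_mul] <;> gcongr
    · rw [div_add_div _ _ (by simpa using hq) (by simpa using hq')]
      simp
  neg_mem' := by
    rintro _ ⟨p, q, hq, hd, rfl⟩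
    exact ⟨-p, q, hq, by simpa using hd, by simp [neg_div]⟩
  mem_or_inv_mem' f := by
    rcases le_or_gt f.num.degree f.denom.degree with h | h
    · exact Or.inl ⟨_, _, f.denom_ne_zero, h, (RatFunc.num_div_denom f).symm⟩
    · refine Or.inr ⟨f.denom, f.num, ?_, h.le, by rw [← inv_div, RatFunc.num_div_denom]⟩
      rintro h0
      simp [h0] at h

theorem mem_ratFuncRegularAtInfty {k : Type*} [Field k] {f : RatFunc k} :
    f ∈ ratFuncRegularAtInfty k ↔ ∃ p q : Polynomial k, q ≠ 0 ∧ p.degree ≤ q.degree ∧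
      f = algebraMap _ (RatFunc k) p / algebraMap _ (RatFunc k) q := Iff.rfl

theorem mem_ratFuncRegularAt_of_mem_regularDifferentials {ω : Ω[RatFunc ℂ⁄ℂ]}
    (hω : ω ∈ regularDifferentials (RatFunc ℂ)) (a : ℂ) :
    ratFuncKaehlerEquiv ℂ ω ∈ ratFuncRegularAt a := by
  have h := hω (ratFuncRegularAt a) fun c => ⟨Polynomial.C c, 1, by simp, by simp⟩
  clear hω
  induction h using Submodule.span_induction with
  | mem x hx =>
    obtain ⟨t, ht, rfl⟩ := hx
    obtain ⟨p, q, hq, rfl⟩ := mem_ratFuncRegularAt.1 ht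
    have hq0 : q ≠ 0 := by rintro rfl; simp at hq
    rw [ratFuncKaehlerEquiv_D_div p q hq0]
    exact ⟨_, q * q, by simp [hq], rfl⟩
  | zero => rw [map_zero]; exact zero_mem _
  | add x y _ _ hx hy => rw [map_add]; exact add_mem hx hy
  | smul b x _ hx =>
    have e : ratFuncKaehlerEquiv ℂ (b • x) = (b : RatFunc ℂ) * ratFuncKaehlerEquiv ℂ x :=
      map_smul (ratFuncKaehlerEquiv ℂ) (b : RatFunc ℂ) x
    rw [e]
    exact mul_mem b.2 hx

/-- Differentiation lowers degrees, so `dt/dX` vanishes at infinity whenever `t` is regular there.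
The true order of vanishing is at least two, but order one already suffices to exclude nonzero
polynomials. -/
theorem vanishes_at_infty_of_mem_regularDifferentials {ω : Ω[RatFunc ℂ⁄ℂ]}
    (hω : ω ∈ regularDifferentials (RatFunc ℂ)) :
    ∃ p q : Polynomial ℂ, q ≠ 0 ∧ p.degree < q.degree ∧
      ratFuncKaehlerEquiv ℂ ω = algebraMap _ (RatFunc ℂ) p / algebraMap _ (RatFunc ℂ) q := by
  have h := hω (ratFuncRegularAtInfty ℂ) fun c =>
    ⟨Polynomial.C c, 1, by simp, by simpa using Polynomial.degree_C_le, by simp⟩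
  clear hω
  induction h using Submodule.span_induction with
  | mem x hx =>
    obtain ⟨t, ht, rfl⟩ := hx
    obtain ⟨p, q, hq, hd, rfl⟩ := mem_ratFuncRegularAtInfty.1 ht
    rw [ratFuncKaehlerEquiv_D_div p q hq]
    refine ⟨_, q * q, mul_ne_zero hq hq, ?_, rfl⟩
    -- Strict inequalities in `WithBot ℕ` survive addition only of a summand other than `⊥`.
    have hq' : q.degree ≠ ⊥ := by simpa using hq
    refine (Polynomial.degree_sub_le _ _).trans_lt (max_lt ?_ ?_)
    · rw [Polynomial.degree_mul, Polynomial.degree_mul]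
      refine WithBot.add_lt_add_right hq' ?_
      rcases eq_or_ne p 0 with rfl | hp
      · simpa [bot_lt_iff_ne_bot] using hq
      · exact (Polynomial.degree_derivative_lt hp).trans_le hd
    · rw [Polynomial.degree_mul, Polynomial.degree_mul]
      refine (add_le_add_left hd _).trans_lt ?_
      exact WithBot.add_lt_add_left hq' (Polynomial.degree_derivative_lt hq)
  | zero => exact ⟨0, 1, one_ne_zero, by simp, by simp⟩
  | add x y _ _ hx hy =>
    obtain ⟨p, q, hq, hd, e⟩ := hx
    obtain ⟨p', q', hq', hd', e'⟩ := hy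
    refine ⟨p * q' + q * p', q * q', mul_ne_zero hq hq', ?_, ?_⟩
    · refine (Polynomial.degree_add_le _ _).trans_lt (max_lt ?_ ?_) <;>
        rw [Polynomial.degree_mul, Polynomial.degree_mul]
      · exact WithBot.add_lt_add_right (by simpa using hq') hd
      · exact WithBot.add_lt_add_left (by simpa using hq) hd'
    · rw [map_add, e, e', div_add_div _ _ (by simpa using hq) (by simpa using hq')]
      simp
  | smul b x _ hx =>
    have e : ratFuncKaehlerEquiv ℂ (b • x) = (b : RatFunc ℂ) * ratFuncKaehlerEquiv ℂ x :=
      map_smul (ratFuncKaehlerEquiv ℂ) (b : RatFunc ℂ) x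
    obtain ⟨p, q, hq, hd, e'⟩ := hx
    obtain ⟨p', q', hq', hd', e''⟩ := mem_ratFuncRegularAtInfty.1 b.2
    refine ⟨p' * p, q' * q, mul_ne_zero hq' hq, ?_, ?_⟩
    · rw [Polynomial.degree_mul, Polynomial.degree_mul]
      refine (add_le_add_left hd' _).trans_lt ?_
      exact WithBot.add_lt_add_left (by simpa using hq') hd
    · rw [e, e', e'', div_mul_div_comm]
      simp

/-- Writing `ω = f dX`, the function `f` has no finite pole, hence is a polynomial; a polynomial
that vanishes at infinity is zero. -/
theorem regularDifferentials_ratFunc : regularDifferentials (RatFunc ℂ) = ⊥ := by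
  rw [eq_bot_iff]
  intro ω hω
  obtain ⟨p, q, hq, hd, e⟩ := vanishes_at_infty_of_mem_regularDifferentials hω
  set f := ratFuncKaehlerEquiv ℂ ω with hf
  have hden : f.denom = 1 := by
    refine Polynomial.eq_one_of_monic_natDegree_zero (RatFunc.monic_denom f) ?_
    by_contra hdeg
    obtain ⟨a, ha⟩ := Complex.exists_root (f := f.denom)
      (Polynomial.natDegree_pos_iff_degree_pos.1 (Nat.pos_of_ne_zero hdeg))
    exact denom_eval_ne_zero_of_mem_ratFuncRegularAt
      (mem_ratFuncRegularAt_of_mem_regularDifferentials hω a) ha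
  have hnum : f = algebraMap _ _ f.num := by
    conv_lhs => rw [← RatFunc.num_div_denom f, hden]
    simp
  have hpq : f.num * q = p := by
    apply FaithfulSMul.algebraMap_injective (Polynomial ℂ) (RatFunc ℂ)
    rw [map_mul, ← hnum, e, div_mul_cancel₀ _ (by simpa using hq)]
  have hn0 : f.num = 0 := by
    by_contra h0
    rw [← hpq, Polynomial.degree_mul] at hd
    have h1 : (0 : WithBot ℕ) ≤ f.num.degree := Polynomial.zero_le_degree_iff.2 h0
    exact absurd hd (not_lt.2 (le_add_of_nonneg_left h1))
  rw [hn0, map_zero, hf] at hnum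
  simpa using hnum

/-! ### Linear disjointness and irreducibility over larger base fields. -/

section LinearDisjointness

attribute [local instance] MvPolynomial.algebraMvPolynomial

variable {K k M : Type*} [Field K] [Field k] [Field M] [Algebra K k] [Algebra k M] [Algebra K M]
  [IsScalarTower K k M] [Algebra (RatFunc K) M] [IsScalarTower K (RatFunc K) M]

/-- If the variable of `K(X)` stays transcendental over an extension `k` of `K`, then `k` and
`K(X)` are linearly disjoint over `K`. -/
theorem linearIndependent_ratFunc_of_transcendental
    (hX : Transcendental k (algebraMap (RatFunc K) M RatFunc.X)) {ι : Type*} {b : ι → k}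
    (hb : LinearIndependent K b) : LinearIndependent (RatFunc K) fun i => algebraMap k M (b i) := by
  rw [linearIndependent_iff']
  intro s g hg
  -- Clearing denominators turns the relation into a polynomial over `k` vanishing at the variable.
  -- By transcendence all its coefficients vanish, and each of them is a `K`-linear relation between
  -- the `b i`.
  obtain ⟨d, hd⟩ := IsLocalization.exist_integer_multiples (nonZeroDivisors (Polynomial K)) s g
  choose! P hP using hd
  have hd0 : algebraMap (Polynomial K) (RatFunc K) d ≠ 0 := by
    simp
  have hval (p : Polynomial K) : algebraMap (RatFunc K) M (algebraMap _ _ p) =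
      Polynomial.aeval (algebraMap (RatFunc K) M RatFunc.X) (p.map (algebraMap K k)) := by
    rw [Polynomial.aeval_map_algebraMap, Polynomial.aeval_algebraMap_apply,
      RatFunc.aeval_X_left_eq_algebraMap]
  have hsum : Polynomial.aeval (algebraMap (RatFunc K) M RatFunc.X)
      (∑ i ∈ s, Polynomial.C (b i) * (P i).map (algebraMap K k)) = 0 := by
    rw [map_sum, ← mul_zero (algebraMap (RatFunc K) M (algebraMap _ _ (d : Polynomial K))), ← hg,
      Finset.mul_sum]
    refine Finset.sum_congr rfl fun i hi => ?_
    rw [map_mul, ← hval, hP i hi, Polynomial.aeval_C, Algebra.smul_def, Algebra.smul_def, map_mul]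
    ring
  have hzero := (transcendental_iff.1 hX) _ hsum
  intro i hi
  have hPi : P i = 0 := by
    ext n
    have hn := congrArg (fun q => Polynomial.coeff q n) hzero
    simp only [Polynomial.finsetSum_coeff, Polynomial.coeff_C_mul, Polynomial.coeff_map,
      Polynomial.coeff_zero] at hn
    refine (linearIndependent_iff'.1 hb) s (fun i => (P i).coeff n) ?_ i hi
    simpa only [Algebra.smul_def, mul_comm] using hn
  have h := hP i hi
  rw [hPi, map_zero, Algebra.smul_def, eq_comm, mul_eq_zero] at h
  exact h.resolve_left hd0

/-- If `f` became equal to some `c` in `k` outside `K`, then `f · 1 - 1 · c = 0` would be a relation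
over `K(X)` between `1` and `c`, which are independent over `K`. -/
theorem notMem_range_algebraMap_of_transcendental
    (hX : Transcendental k (algebraMap (RatFunc K) M RatFunc.X)) {f : RatFunc K}
    (hf : f ∉ Set.range (algebraMap K (RatFunc K))) :
    algebraMap (RatFunc K) M f ∉ Set.range (algebraMap k M) := by
  rintro ⟨c, hc⟩
  by_cases hcK : c ∈ Set.range (algebraMap K k)
  · obtain ⟨a, rfl⟩ := hcK
    refine hf ⟨a, (algebraMap (RatFunc K) M).injective ?_⟩
    rw [← hc, ← IsScalarTower.algebraMap_apply, ← IsScalarTower.algebraMap_apply]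
  · have hli : LinearIndependent K ![1, c] := by
      rw [LinearIndependent.pair_iff' one_ne_zero]
      intro a ha
      exact hcK ⟨a, by rw [← ha, Algebra.smul_def, mul_one]⟩
    have h := Fintype.linearIndependent_iff.1
      (linearIndependent_ratFunc_of_transcendental (M := M) hX hli) ![f, -1]
      (by simp [Fin.sum_univ_two, Algebra.smul_def, hc]) 1
    simp at h

theorem mvPolynomial_mem_span_basis {σ ι : Type*} (b : Module.Basis ι K k) (G : MvPolynomial σ k) :
    G ∈ Submodule.span (MvPolynomial σ K)
      (Set.range fun i => (MvPolynomial.C (b i) : MvPolynomial σ k)) := by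
  have hC (c : k) : (MvPolynomial.C c : MvPolynomial σ k) ∈ Submodule.span (MvPolynomial σ K)
      (Set.range fun i => (MvPolynomial.C (b i) : MvPolynomial σ k)) := by
    have hc : c ∈ Submodule.span K (Set.range b) := by simp [b.span_eq]
    induction hc using Submodule.span_induction with
    | mem x hx => obtain ⟨i, rfl⟩ := hx; exact Submodule.subset_span ⟨i, rfl⟩
    | zero => rw [map_zero]; exact Submodule.zero_mem _
    | add x y _ _ hx hy => rw [map_add]; exact Submodule.add_mem _ hx hy
    | smul a x _ hx =>
      have e : (MvPolynomial.C (a • x) : MvPolynomial σ k) =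
          (MvPolynomial.C a : MvPolynomial σ K) • MvPolynomial.C x := by
        rw [Algebra.smul_def, Algebra.smul_def, MvPolynomial.algebraMap_def, MvPolynomial.map_C,
          map_mul]
      rw [e]
      exact Submodule.smul_mem _ _ hx
  induction G using MvPolynomial.induction_on with
  | C c => exact hC c
  | add p q hp hq => exact Submodule.add_mem _ hp hq
  | mul_X p i hp =>
    have e : p * MvPolynomial.X i = (MvPolynomial.X i : MvPolynomial σ K) • p := by
      rw [Algebra.smul_def, MvPolynomial.algebraMap_def, MvPolynomial.map_X, mul_comm]
    rw [e]
    exact Submodule.smul_mem _ _ hp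

/-- Expand `G` along a `K`-basis of `k`, with coefficients polynomials over `K`. If `G` vanishes at
`v`, linear disjointness makes each coefficient vanish at `v`, so `F` divides every one of them. -/
theorem ker_aeval_eq_span_map
    (hX : Transcendental k (algebraMap (RatFunc K) M RatFunc.X)) {σ : Type*} (v : σ → RatFunc K)
    {F : MvPolynomial σ K}
    (hF : RingHom.ker (MvPolynomial.aeval v : MvPolynomial σ K →ₐ[K] RatFunc K) = Ideal.span {F}) :
    RingHom.ker (MvPolynomial.aeval (fun i => algebraMap (RatFunc K) M (v i)) :
      MvPolynomial σ k →ₐ[k] M) = Ideal.span {MvPolynomial.map (algebraMap K k) F} := by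
  have hmap (p : MvPolynomial σ K) :
      (MvPolynomial.aeval (fun i => algebraMap (RatFunc K) M (v i)) : MvPolynomial σ k →ₐ[k] M)
        (MvPolynomial.map (algebraMap K k) p) =
      algebraMap (RatFunc K) M (MvPolynomial.aeval v p) := by
    rw [MvPolynomial.aeval_map_algebraMap]
    exact MvPolynomial.aeval_algebraMap_apply M v p
  have hF0 (p : MvPolynomial σ K) : MvPolynomial.aeval v p = 0 ↔ F ∣ p := by
    rw [← Ideal.mem_span_singleton, ← hF, RingHom.mem_ker]
  apply le_antisymm
  · intro G hG
    let b := Module.Basis.ofVectorSpace K k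
    obtain ⟨c, rfl⟩ := Finsupp.mem_span_range_iff_exists_finsupp.1 (mvPolynomial_mem_span_basis b G)
    refine Submodule.sum_mem _ fun i hi => ?_
    have hc : MvPolynomial.aeval v (c i) = 0 := by
      refine linearIndependent_iff'.1
        (linearIndependent_ratFunc_of_transcendental (M := M) hX b.linearIndependent) c.support
        (fun i => MvPolynomial.aeval v (c i)) ?_ i hi
      rw [RingHom.mem_ker, Finsupp.sum, map_sum] at hG
      rw [← hG]
      refine Finset.sum_congr rfl fun j _ => ?_
      rw [Algebra.smul_def, Algebra.smul_def, map_mul, MvPolynomial.algebraMap_def, hmap,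
        MvPolynomial.aeval_C]
    simp only [Algebra.smul_def, MvPolynomial.algebraMap_def]
    exact Ideal.mul_mem_right _ _ (Ideal.mem_span_singleton.2 (map_dvd _ ((hF0 _).1 hc)))
  · rw [Ideal.span_singleton_le_iff_mem, RingHom.mem_ker, hmap, (hF0 F).2 dvd_rfl, map_zero]

/-- The extended polynomial generates the kernel of a map to a field, hence a prime ideal. -/
theorem irreducible_map_of_ker_aeval_eq_span
    (hX : Transcendental k (algebraMap (RatFunc K) M RatFunc.X)) {σ : Type*} (v : σ → RatFunc K)
    {F : MvPolynomial σ K} (hF0 : F ≠ 0)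
    (hF : RingHom.ker (MvPolynomial.aeval v : MvPolynomial σ K →ₐ[K] RatFunc K) = Ideal.span {F}) :
    Irreducible (MvPolynomial.map (algebraMap K k) F) := by
  refine Prime.irreducible ((Ideal.span_singleton_prime ?_).1 ?_)
  · rwa [Ne, map_eq_zero_iff _ (MvPolynomial.map_injective _ (algebraMap K k).injective)]
  · rw [← ker_aeval_eq_span_map (M := M) hX v hF]
    exact RingHom.ker_isPrime _

end LinearDisjointness

/-! ### Ultrapowers of fields and transfer for polynomials of bounded degree. -/

/-- The ultrapower of `R` along the ultrafilter `U`. -/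
def Ultrapower {ι : Type*} (U : Ultrafilter ι) (R : Type*) : Type _ :=
  Filter.Germ (U : Filter ι) R

namespace Ultrapower

variable {ι : Type*} {U : Ultrafilter ι} {R S : Type*} [Field R] [Field S]

instance : Field (Ultrapower U R) := inferInstanceAs (Field (Filter.Germ (U : Filter ι) R))

variable (U R) in
/-- The class of a family in the ultrapower. -/
def mk : (ι → R) →+* Ultrapower U R := Filter.Germ.coeRingHom (U : Filter ι)

theorem mk_eq_mk {f g : ι → R} : mk U R f = mk U R g ↔ ∀ᶠ x in (U : Filter ι), f x = g x :=
  Filter.Germ.coe_eq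

theorem mk_eq_zero {f : ι → R} : mk U R f = 0 ↔ ∀ᶠ x in (U : Filter ι), f x = 0 := by
  rw [← map_zero (mk U R), mk_eq_mk]; rfl

theorem mk_surjective : Function.Surjective (mk U R) := fun x =>
  Filter.Germ.inductionOn x fun f => ⟨f, rfl⟩

variable (U) in
/-- The map of ultrapowers induced by a ring homomorphism. -/
def map (f : R →+* S) : Ultrapower U R →+* Ultrapower U S where
  toFun := Filter.Germ.map f
  map_one' := (mk_eq_mk (f := fun _ => f 1) (g := fun _ => 1)).2 (by simp)
  map_zero' := (mk_eq_mk (f := fun _ => f 0) (g := fun _ => 0)).2 (by simp)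
  map_mul' x y := by
    obtain ⟨a, rfl⟩ := mk_surjective x
    obtain ⟨b, rfl⟩ := mk_surjective y
    exact (mk_eq_mk (f := fun i => f (a i * b i)) (g := fun i => f (a i) * f (b i))).2 (by simp)
  map_add' x y := by
    obtain ⟨a, rfl⟩ := mk_surjective x
    obtain ⟨b, rfl⟩ := mk_surjective y
    exact (mk_eq_mk (f := fun i => f (a i + b i)) (g := fun i => f (a i) + f (b i))).2 (by simp)

instance [Algebra R S] : Algebra (Ultrapower U R) (Ultrapower U S) :=
  (map U (algebraMap R S)).toAlgebra

theorem algebraMap_mk [Algebra R S] (a : ι → R) :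
    algebraMap (Ultrapower U R) (Ultrapower U S) (mk U R a) =
      mk U S fun i => algebraMap R S (a i) := rfl

/-- A polynomial relation involves finitely many coefficients, so it holds in almost every
component, where `X` is transcendental over `R`. -/
theorem transcendental_mk_X :
    Transcendental (Ultrapower U R) (mk U (RatFunc R) fun _ => RatFunc.X) := by
  rw [transcendental_iff]
  intro P hP
  choose c hc using fun n => mk_surjective (U := U) (P.coeff n)
  have h : mk U (RatFunc R) (fun x => ∑ n ∈ Finset.range (P.natDegree + 1),
      algebraMap R (RatFunc R) (c n x) * RatFunc.X ^ n) = 0 := by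
    rw [← hP, Polynomial.aeval_eq_sum_range]
    have e : (fun x => ∑ n ∈ Finset.range (P.natDegree + 1),
        algebraMap R (RatFunc R) (c n x) * RatFunc.X ^ n) =
        ∑ n ∈ Finset.range (P.natDegree + 1),
          (fun x : ι => algebraMap R (RatFunc R) (c n x)) * (fun _ => RatFunc.X) ^ n := by
      funext x; simp
    rw [e, map_sum]
    refine Finset.sum_congr rfl fun n _ => ?_
    rw [map_mul, map_pow, Algebra.smul_def, ← hc, algebraMap_mk]
  rw [mk_eq_zero] at h
  ext n
  rw [Polynomial.coeff_zero]
  rcases lt_or_ge P.natDegree n with hn | hn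
  · exact Polynomial.coeff_eq_zero_of_natDegree_lt hn
  rw [← hc, mk_eq_zero]
  filter_upwards [h] with x hx
  have hp : (∑ n ∈ Finset.range (P.natDegree + 1), Polynomial.monomial n (c n x)) = 0 := by
    apply FaithfulSMul.algebraMap_injective (Polynomial R) (RatFunc R)
    rw [map_zero, map_sum, ← hx]
    refine Finset.sum_congr rfl fun n _ => ?_
    rw [← Polynomial.C_mul_X_pow_eq_monomial, map_mul, map_pow, RatFunc.algebraMap_X,
      RatFunc.algebraMap_C]
    rfl
  have := congrArg (fun p => Polynomial.coeff p n) hp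
  simpa [Polynomial.finsetSum_coeff, Polynomial.coeff_monomial, hn] using this

section MvPolynomial

variable {σ : Type*}

/-- A polynomial over the ultrapower whose coefficients are the classes of the coefficients of a
family of polynomials. -/
def Represents (P : MvPolynomial σ (Ultrapower U R)) (p : ι → MvPolynomial σ R) : Prop :=
  ∀ m, P.coeff m = mk U R fun x => (p x).coeff m

theorem Represents.mul {P Q : MvPolynomial σ (Ultrapower U R)} {p q : ι → MvPolynomial σ R}
    (hP : Represents P p) (hQ : Represents Q q) : Represents (P * Q) fun x => p x * q x := by
  classical
  intro m
  have e : (fun x => (p x * q x).coeff m) = ∑ y ∈ Finset.HasAntidiagonal.antidiagonal m,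
      (fun x => (p x).coeff y.1) * fun x => (q x).coeff y.2 := by
    funext x
    simp [MvPolynomial.coeff_mul]
  rw [e, MvPolynomial.coeff_mul, map_sum]
  exact Finset.sum_congr rfl fun y _ => by rw [map_mul, hP, hQ]

theorem Represents.unique {P Q : MvPolynomial σ (Ultrapower U R)} {p q : ι → MvPolynomial σ R}
    (hP : Represents P p) (hQ : Represents Q q) (h : ∀ᶠ x in (U : Filter ι), p x = q x) :
    P = Q := by
  ext m
  rw [hP, hQ, mk_eq_mk]
  exact h.mono fun x hx => by rw [hx]

/-- The degree bound leaves finitely many monomials, so the classes of the coefficients form a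
polynomial. -/
theorem exists_represents_of_totalDegree_le [Finite σ] {p : ι → MvPolynomial σ R} (d : ℕ)
    (hp : ∀ᶠ x in (U : Filter ι), (p x).totalDegree ≤ d) :
    ∃ P : MvPolynomial σ (Ultrapower U R), Represents P p := by
  classical
  let s : Finset (σ →₀ ℕ) := (Finsupp.finite_of_degree_le d).toFinset
  refine ⟨∑ m ∈ s, MvPolynomial.monomial m (mk U R fun x => (p x).coeff m), fun m => ?_⟩
  simp only [MvPolynomial.coeff_sum, MvPolynomial.coeff_monomial, Finset.sum_ite_eq']
  split_ifs with hm
  · rfl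
  · rw [eq_comm, mk_eq_zero]
    filter_upwards [hp] with x hx
    refine MvPolynomial.coeff_eq_zero_of_totalDegree_lt (hx.trans_lt ?_)
    have hmd : ¬ m.degree ≤ d := by simpa [s] using hm
    exact not_le.1 hmd

/-- A unit over a field is constant. The finitely many other coefficients allowed by the degree
bound each vanish on a set of `U`, hence simultaneously on one. -/
theorem Represents.eventually_eq_C [Finite σ] {P : MvPolynomial σ (Ultrapower U R)}
    {p : ι → MvPolynomial σ R} (hP : Represents P p) {d : ℕ}
    (hp : ∀ᶠ x in (U : Filter ι), (p x).totalDegree ≤ d) (hunit : IsUnit P) :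
    ∀ᶠ x in (U : Filter ι), p x = MvPolynomial.C ((p x).coeff 0) := by
  classical
  obtain ⟨c, -, rfl⟩ := MvPolynomial.isUnit_iff_eq_C_of_isReduced.1 hunit
  have h : ∀ᶠ x in (U : Filter ι), ∀ m ∈ (Finsupp.finite_of_degree_le (σ := σ) d).toFinset,
      m ≠ 0 → (p x).coeff m = 0 := by
    rw [Filter.eventually_all_finset]
    intro m _
    by_cases hm : m = 0
    · simp [hm]
    have := hP m
    rw [MvPolynomial.coeff_C, if_neg (Ne.symm hm), eq_comm, mk_eq_zero] at this
    exact this.mono fun x hx _ => hx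
  filter_upwards [h, hp] with x hx hd
  ext m
  rw [MvPolynomial.coeff_C]
  split_ifs with hm
  · rw [hm]
  by_cases hmd : m.degree ≤ d
  · exact hx m (by simpa using hmd) (Ne.symm hm)
  · exact MvPolynomial.coeff_eq_zero_of_totalDegree_lt (hd.trans_lt (not_le.1 hmd))

theorem eq_C_of_coeff_eq_zero {R : Type*} [CommSemiring R] {p : MvPolynomial σ R}
    (h : ∀ m, m ≠ 0 → p.coeff m = 0) : p = MvPolynomial.C (p.coeff 0) := by
  classical
  ext m
  rw [MvPolynomial.coeff_C]
  split_ifs with hm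
  · rw [hm]
  · exact h m (Ne.symm hm)

/-- If the ultraproduct of a family of polynomials of bounded degree is irreducible, then so are
almost all members of the family. -/
theorem Represents.eventually_irreducible [Finite σ] {P : MvPolynomial σ (Ultrapower U R)}
    {p : ι → MvPolynomial σ R} (hP : Represents P p) {d : ℕ}
    (hp : ∀ᶠ x in (U : Filter ι), (p x).totalDegree ≤ d) (hirr : Irreducible P) :
    ∀ᶠ x in (U : Filter ι), Irreducible (p x) := by
  by_contra hcon
  rw [← Ultrafilter.eventually_not] at hcon
  -- A nonzero nonconstant coefficient of `P` is nonzero in almost all `p x`. These are then neither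
  -- zero nor units, so those that are not irreducible factor properly.
  have hnc : ∃ m, m ≠ 0 ∧ P.coeff m ≠ 0 := by
    by_contra! h
    have hC := eq_C_of_coeff_eq_zero h
    refine hirr.not_isUnit ?_
    rw [hC]
    refine IsUnit.map MvPolynomial.C (isUnit_iff_ne_zero.2 fun h0 => hirr.ne_zero ?_)
    rw [hC, h0, map_zero]
  obtain ⟨m, hm0, hm⟩ := hnc
  have hm' : ∀ᶠ x in (U : Filter ι), (p x).coeff m ≠ 0 := by
    rw [Ultrafilter.eventually_not, ← mk_eq_zero, ← hP]
    exact hm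
  have hfac : ∀ᶠ x in (U : Filter ι), ∃ ab : MvPolynomial σ R × MvPolynomial σ R,
      p x = ab.1 * ab.2 ∧ ¬ IsUnit ab.1 ∧ ¬ IsUnit ab.2 := by
    filter_upwards [hcon, hm'] with x hx hxm
    by_contra! h
    refine hx ⟨fun hu => ?_, fun a b hab => ?_⟩
    · obtain ⟨c, -, hc⟩ := MvPolynomial.isUnit_iff_eq_C_of_isReduced.1 hu
      classical
      rw [hc, MvPolynomial.coeff_C, if_neg (Ne.symm hm0)] at hxm
      exact hxm rfl
    · by_contra! hn
      exact hn.2 (h (a, b) hab hn.1)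
  obtain ⟨f, hf⟩ := hfac.choice
  have hp0 : ∀ᶠ x in (U : Filter ι), p x ≠ 0 := hm'.mono fun x hx h => hx (by rw [h]; simp)
  -- Total degree is additive over a field, so the factors inherit the bound `d` and have
  -- ultraproducts `A` and `B`.
  have hdeg : ∀ᶠ x in (U : Filter ι), (f x).1.totalDegree ≤ d ∧ (f x).2.totalDegree ≤ d := by
    filter_upwards [hf, hp0, hp] with x hx hx0 hd
    have hne := hx0
    rw [hx.1, mul_ne_zero_iff] at hne
    rw [hx.1, MvPolynomial.totalDegree_mul_of_isDomain hne.1 hne.2] at hd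
    omega
  obtain ⟨A, hA⟩ := exists_represents_of_totalDegree_le d (hdeg.mono fun x hx => hx.1)
  obtain ⟨B, hB⟩ := exists_represents_of_totalDegree_le d (hdeg.mono fun x hx => hx.2)
  have hAB : P = A * B := hP.unique (hA.mul hB) (hf.mono fun x hx => hx.1)
  have hunit {q : MvPolynomial σ R} (hq : q = MvPolynomial.C (q.coeff 0)) (h0 : q ≠ 0) :
      IsUnit q := by
    rw [hq]
    refine IsUnit.map MvPolynomial.C (isUnit_iff_ne_zero.2 fun h => h0 ?_)
    rw [hq, h, map_zero]
  have hne : ∀ᶠ x in (U : Filter ι), (f x).1 ≠ 0 ∧ (f x).2 ≠ 0 := by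
    filter_upwards [hf, hp0] with x hx hx0
    rwa [hx.1, mul_ne_zero_iff] at hx0
  rcases hirr.isUnit_or_isUnit hAB with h | h
  · obtain ⟨x, hx, hC, hx0⟩ := (hf.and ((hA.eventually_eq_C (hdeg.mono fun x hx => hx.1) h).and
      hne)).exists
    exact hx.2.1 (hunit hC hx0.1)
  · obtain ⟨x, hx, hC, hx0⟩ := (hf.and ((hB.eventually_eq_C (hdeg.mono fun x hx => hx.2) h).and
      hne)).exists
    exact hx.2.2 (hunit hC hx0.2)

/-- A point with coordinates in the ultrapower lies on the ultraproduct of a family of polynomials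
with supports in a fixed finite set only if almost all its components lie on the members. -/
theorem Represents.eventually_aeval_eq_zero [Algebra R S] {P : MvPolynomial σ (Ultrapower U R)}
    {p : ι → MvPolynomial σ R} (hP : Represents P p) (hp : ∀ x, (p x).support ⊆ P.support)
    (w : σ → ι → S) (h : MvPolynomial.aeval (fun i => mk U S (w i)) P = 0) :
    ∀ᶠ x in (U : Filter ι), MvPolynomial.aeval (fun i => w i x) (p x) = 0 := by
  rw [← mk_eq_zero, ← h]
  have e : (fun x => MvPolynomial.aeval (fun i => w i x) (p x)) = ∑ m ∈ P.support,
      (fun x => algebraMap R S ((p x).coeff m)) * ∏ i ∈ m.support, w i ^ m i := by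
    funext x
    rw [MvPolynomial.aeval_def, MvPolynomial.eval₂_eq, Finset.sum_apply]
    -- Summing over the support of `P` makes the index set independent of `x`, so that the sum
    -- commutes with taking classes.
    refine (Finset.sum_subset (hp x) fun m _ hm => ?_).trans (Finset.sum_congr rfl fun m _ => ?_)
    · rw [MvPolynomial.notMem_support_iff.1 hm, map_zero, zero_mul]
    · simp
  rw [e, map_sum, MvPolynomial.aeval_def, MvPolynomial.eval₂_eq]
  refine Finset.sum_congr rfl fun m _ => ?_
  rw [map_mul, map_prod, hP, algebraMap_mk]
  simp only [map_pow]

end MvPolynomial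

end Ultrapower

/-! ### Specialized curves and the genus of a parametrized curve. -/

theorem coeff_specializeAt (F : MvPolynomial (Fin 2) (RatFunc ℂ)) (z₀ : ℂ) (m : Fin 2 →₀ ℕ) :
    (specializeAt F z₀).coeff m = (F.coeff m).eval (RingHom.id ℂ) z₀ := by
  classical
  simp only [specializeAt, MvPolynomial.coeff_sum, MvPolynomial.coeff_monomial,
    Finset.sum_ite_eq']
  split_ifs with hm
  · rfl
  · rw [MvPolynomial.notMem_support_iff.1 hm, RatFunc.eval_zero]

theorem support_specializeAt_subset (F : MvPolynomial (Fin 2) (RatFunc ℂ)) (z₀ : ℂ) :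
    (specializeAt F z₀).support ⊆ F.support := by
  intro m hm
  rw [MvPolynomial.mem_support_iff, coeff_specializeAt] at hm
  rw [MvPolynomial.mem_support_iff]
  rintro h
  exact hm (by rw [h, RatFunc.eval_zero])

/-- A nonconstant element of `ℂ(λ)` is transcendental over `ℂ`, so `w` is a generic point of the
curve and the function field embeds in `ℂ(λ)`. Pulling back differentials avoids Lüroth's theorem.
-/
theorem planeCurveGenus_eq_zero_of_parametrization {f : MvPolynomial (Fin 2) ℂ}
    (hf : Irreducible f) (w : Fin 2 → RatFunc ℂ) (hw : MvPolynomial.aeval w f = 0)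
    (hw0 : w 0 ∉ Set.range (algebraMap ℂ (RatFunc ℂ))) : planeCurveGenus f hf = 0 := by
  have : IsDomain (CoordRing f) := isDomain_coordRing hf
  have htr : Transcendental ℂ (w 0) :=
    RatFunc.transcendental_of_ne_C _ fun ⟨c, hc⟩ => hw0 ⟨c, by rw [hc]; rfl⟩
  have hker : RingHom.ker (MvPolynomial.aeval w : MvPolynomial (Fin 2) ℂ →ₐ[ℂ] RatFunc ℂ) =
      Ideal.span {f} :=
    ker_eq_span_of_transcendental hf (MvPolynomial.aeval w) hw 0 (by simpa using htr)
  let g : CoordRing f →ₐ[ℂ] RatFunc ℂ :=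
    Ideal.Quotient.liftₐ (Ideal.span {f}) (MvPolynomial.aeval w) fun a ha => by
      rwa [← hker, RingHom.mem_ker] at ha
  have hg : Function.Injective g := by
    refine (injective_iff_map_eq_zero g).2 fun x hx => ?_
    obtain ⟨a, rfl⟩ := Ideal.Quotient.mk_surjective x
    rw [Ideal.Quotient.eq_zero_iff_mem, ← hker, RingHom.mem_ker]
    exact hx
  have h := regularDifferentials_eq_bot_of_algHom
    (IsFractionRing.liftAlgHom (K := FractionRing (CoordRing f)) hg) regularDifferentials_ratFunc
  change Module.rank ℂ (regularDifferentials (FractionRing (CoordRing f))) = 0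
  rw [h]
  exact rank_bot ℂ _

/-! ### Embedding `ℂ(z)` and `ℂ(z, λ)` in ultrapowers by specialization of `z`. -/

section Ultraproduct

variable (U : Ultrafilter ℂ) [hU : Fact ((U : Filter ℂ) ≤ Filter.cofinite)]

theorem eventually_eval_denom_ne_zero {U : Ultrafilter ℂ} (hU : (U : Filter ℂ) ≤ Filter.cofinite)
    (a : RatFunc ℂ) : ∀ᶠ z in (U : Filter ℂ), a.denom.eval₂ (RingHom.id ℂ) z ≠ 0 := by
  refine hU ?_
  change {z : ℂ | ¬ a.denom.eval₂ (RingHom.id ℂ) z ≠ 0}.Finite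
  refine (Polynomial.finite_setOfPred_isRoot a.denom_ne_zero).subset fun z hz => ?_
  simpa [Polynomial.eval₂_id] using hz

/-- The embedding of `ℂ(z)` in the ultrapower of `ℂ` by the values of a rational function. -/
def evalUltrapower : RatFunc ℂ →+* Ultrapower U ℂ where
  toFun a := Ultrapower.mk U ℂ fun z => a.eval (RingHom.id ℂ) z
  map_one' := by
    rw [← map_one (Ultrapower.mk U ℂ)]; congr 1; funext z; exact RatFunc.eval_one _ _
  map_zero' := by
    rw [← map_zero (Ultrapower.mk U ℂ)]; congr 1; funext z; exact RatFunc.eval_zero _ _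
  -- At a pole `RatFunc.eval` divides by zero and is not multiplicative. The poles are finitely
  -- many, and a filter below the cofinite one ignores them; the same holds for addition.
  map_mul' a b := by
    rw [← map_mul, Ultrapower.mk_eq_mk]
    filter_upwards [eventually_eval_denom_ne_zero hU.out a,
      eventually_eval_denom_ne_zero hU.out b] with z ha hb
    exact RatFunc.eval_mul _ _ ha hb
  map_add' a b := by
    rw [← map_add, Ultrapower.mk_eq_mk]
    filter_upwards [eventually_eval_denom_ne_zero hU.out a,
      eventually_eval_denom_ne_zero hU.out b] with z ha hb
    exact RatFunc.eval_add _ _ ha hb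

instance : Algebra (RatFunc ℂ) (Ultrapower U ℂ) := (evalUltrapower U).toAlgebra

instance : Algebra (RatFunc ℂ) (Ultrapower U (RatFunc ℂ)) :=
  ((algebraMap (Ultrapower U ℂ) (Ultrapower U (RatFunc ℂ))).comp (evalUltrapower U)).toAlgebra

instance : IsScalarTower (RatFunc ℂ) (Ultrapower U ℂ) (Ultrapower U (RatFunc ℂ)) :=
  IsScalarTower.of_algebraMap_eq fun _ => rfl

theorem transcendental_ultrapower_X : Transcendental (RatFunc ℂ)
    (Ultrapower.mk U (RatFunc ℂ) fun _ => RatFunc.X) :=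
  Ultrapower.transcendental_mk_X.restrictScalars (algebraMap (RatFunc ℂ) _).injective

/-- The embedding of `ℂ(z, lam)` in the ultrapower of `ℂ(lam)` by specialization of `z`. -/
def specializeUltrapower : RatFunc (RatFunc ℂ) →ₐ[RatFunc ℂ] Ultrapower U (RatFunc ℂ) :=
  RatFunc.liftAlgHom (Polynomial.aeval (Ultrapower.mk U (RatFunc ℂ) fun _ => RatFunc.X))
    (nonZeroDivisors_le_comap_nonZeroDivisors_of_injective _
      (transcendental_iff_injective.1 (transcendental_ultrapower_X U)))

instance : Algebra (RatFunc (RatFunc ℂ)) (Ultrapower U (RatFunc ℂ)) :=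
  (specializeUltrapower U).toRingHom.toAlgebra

instance : IsScalarTower (RatFunc ℂ) (RatFunc (RatFunc ℂ)) (Ultrapower U (RatFunc ℂ)) :=
  IsScalarTower.of_algebraMap_eq fun a => ((specializeUltrapower U).commutes a).symm

theorem algebraMap_ultrapower_X :
    algebraMap (RatFunc (RatFunc ℂ)) (Ultrapower U (RatFunc ℂ)) RatFunc.X =
      Ultrapower.mk U (RatFunc ℂ) fun _ => RatFunc.X := by
  change specializeUltrapower U RatFunc.X = _
  rw [← RatFunc.algebraMap_X, specializeUltrapower, RatFunc.liftAlgHom_apply]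
  simp

theorem represents_specializeAt (F : MvPolynomial (Fin 2) (RatFunc ℂ)) :
    Ultrapower.Represents (MvPolynomial.map (algebraMap (RatFunc ℂ) (Ultrapower U ℂ)) F)
      (specializeAt F) := by
  intro m
  simp only [MvPolynomial.coeff_map, coeff_specializeAt]
  rfl

/-- The image of `λ` is the class of the constant family `X`, hence transcendental over the
ultrapower of `ℂ`. So both the irreducibility of `F` and the nonconstancy of `r` persist there, and
they descend to almost all components. -/
theorem eventually_irreducible_and_genus_eq_zero {F : MvPolynomial (Fin 2) (RatFunc ℂ)}
    (hF : Irreducible F) {r s : RatFuncZLam} (hrs : MvPolynomial.aeval ![r, s] F = 0)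
    (hr : r ∉ Set.range (algebraMap (RatFunc ℂ) RatFuncZLam)) :
    ∀ᶠ z in (U : Filter ℂ), ∃ h : Irreducible (specializeAt F z),
      planeCurveGenus (specializeAt F z) h = 0 := by
  have hX : Transcendental (Ultrapower U ℂ)
      (algebraMap (RatFunc (RatFunc ℂ)) (Ultrapower U (RatFunc ℂ)) RatFunc.X) := by
    rw [algebraMap_ultrapower_X]
    exact Ultrapower.transcendental_mk_X
  have htr : Transcendental (RatFunc ℂ) r :=
    RatFunc.transcendental_of_ne_C _ fun ⟨c, hc⟩ => hr ⟨c, by rw [hc]; rfl⟩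
  have hker := ker_eq_span_of_transcendental hF (MvPolynomial.aeval ![r, s]) hrs 0
    (by simpa using htr)
  have hrep := represents_specializeAt U F
  have hsupp : (MvPolynomial.map (algebraMap (RatFunc ℂ) (Ultrapower U ℂ)) F).support =
      F.support :=
    MvPolynomial.support_map_of_injective _ (algebraMap (RatFunc ℂ) (Ultrapower U ℂ)).injective
  have hirr := hrep.eventually_irreducible (d := F.totalDegree)
    (Filter.Eventually.of_forall fun z =>
      Finset.sup_mono (support_specializeAt_subset F z))
    (irreducible_map_of_ker_aeval_eq_span (M := Ultrapower U (RatFunc ℂ)) hX _ hF.ne_zero hker)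
  -- Representatives of the images of `r` and `s`: the component of `w` at `z` is the candidate
  -- parametrization of the curve specialized at `z`.
  choose w hw using fun i => Ultrapower.mk_surjective
    (algebraMap RatFuncZLam (Ultrapower U (RatFunc ℂ)) (![r, s] i))
  have hzero := hrep.eventually_aeval_eq_zero
    (fun z => (support_specializeAt_subset F z).trans hsupp.ge) w (by
      simp only [hw]
      rw [MvPolynomial.aeval_map_algebraMap]
      exact (MvPolynomial.aeval_algebraMap_apply _ _ F).trans (by rw [hrs, map_zero]))
  -- If almost all components were constant, the image of `r` would come from the ultrapower of `ℂ`.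
  have hconst : ∀ᶠ z in (U : Filter ℂ), w 0 z ∉ Set.range (algebraMap ℂ (RatFunc ℂ)) := by
    rw [Ultrafilter.eventually_not]
    intro h
    obtain ⟨c, hc⟩ := h.choice
    refine notMem_range_algebraMap_of_transcendental (k := Ultrapower U ℂ) hX hr
      ⟨Ultrapower.mk U ℂ c, ?_⟩
    rw [Ultrapower.algebraMap_mk, show r = ![r, s] 0 from rfl, ← hw, Ultrapower.mk_eq_mk]
    exact hc
  filter_upwards [hirr, hzero, hconst] with z h1 h2 h3
  exact ⟨h1, planeCurveGenus_eq_zero_of_parametrization h1 _ h2 h3⟩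

end Ultraproduct

end

theorem mainTheorem1 (F : MvPolynomial (Fin 2) (RatFunc ℂ)) (hF : Irreducible F)
    (hsol : ∃ r : RatFuncZLam, IsRationalGeneralSolution F r) :
    {z₀ : ℂ | ¬ ∃ h : Irreducible (specializeAt F z₀),
      planeCurveGenus (specializeAt F z₀) h = 0}.Finite := by
  obtain ⟨r, hr⟩ := hsol
  by_contra hinf
  have hne := Set.Infinite.cofinite_inf_principal_neBot hinf
  -- The bad set is infinite, so it meets every cofinite set, and some ultrafilter contains it
  -- together with all cofinite sets.
  let U := Ultrafilter.of (Filter.cofinite ⊓ Filter.principal {z₀ : ℂ |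
    ¬ ∃ h : Irreducible (specializeAt F z₀), planeCurveGenus (specializeAt F z₀) h = 0})
  have hU := Ultrafilter.of_le (Filter.cofinite ⊓ Filter.principal {z₀ : ℂ |
    ¬ ∃ h : Irreducible (specializeAt F z₀), planeCurveGenus (specializeAt F z₀) h = 0})
  have : Fact ((U : Filter ℂ) ≤ Filter.cofinite) := ⟨hU.trans inf_le_left⟩
  have hbad : ∀ᶠ z in (U : Filter ℂ), ¬ ∃ h : Irreducible (specializeAt F z),
      planeCurveGenus (specializeAt F z) h = 0 :=
    (hU.trans inf_le_right) (Filter.mem_principal_self _)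
  obtain ⟨z, hz, hz'⟩ := (hbad.and (eventually_irreducible_and_genus_eq_zero U hF hr.solves
    hr.depends_on_constant)).exists
  exact hz hz'
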